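/- For a complex Banach space $X$ let $B_X$ be its open unit ball. For complex Banach spaces $X,Y$ let $\mathcal{H}L_0(B_X,Y)$ be the space of all holomorphic (complex Fréchet differentiable) Lipschitz functions $f\colon B_X\to Y$ with $f(0)=0$, normed by the Lipschitz constant $L(f)=\sup_{x\neq y}\frac{\|f(x)-f(y)\|}{\|x-y\|}$, and put $\mathcal{H}L_0(B_X)=\mathcal{H}L_0(B_X,\mathbb{C})$. For $\phi\in\mathcal{H}L_0(B_Y,X)$ with $\phi(B_Y)\subseteq B_X$ let $C_\phi\colon\mathcal{H}L_0(B_X)\to\mathcal{H}L_0(B_Y)$, $C_\phi(f)=f\circ\phi$, be the associated composition operator. A Banach space $Y$ has the bounded approximation property (BAP) if there is $\lambda>0$ such that for every compact $K\subseteq Y$ and every $\varepsilon>0$ there is a bounded finite-rank linear operator $T\colon Y\to Y$ with $\|T\|\le\lambda$ and $\|Ty-y\|<\varepsilon$ for all $y\in K$. **Corollary.** Let $X,Y$ be complex Banach spaces such that $Y$ has the BAP. Let $\phi\in\mathcal{H}L_0(B_Y,X)$ with $\phi(B_Y)\subseteq B_X$. Then the following assertions are equivalent. 1. $C_\phi\colon\mathcal{H}L_0(B_X)\to\mathcal{H}L_0(B_Y)$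 is an onto isometry. 2. $C_\phi\colon\mathcal{H}L_0(B_X)\to\mathcal{H}L_0(B_Y)$ is an onto isomorphism (a linear homeomorphism). 3. $\phi\colon B_Y\to B_X$ is a bijection and $\phi^{-1}\in\mathcal{H}L_0(B_X,Y)$. 4. $\phi$ is the restriction to $B_Y$ of an onto (complex) linear isometry $T\colon Y\to X$. -/

import Mathlib

/-- The open unit ball `B_E` of a normed space `E`. -/
abbrev OpenUnitBall (E : Type*) [NormedAddCommGroup E] : Type _ :=
  ↥(Metric.ball (0 : E) 1)

/-- The centre of the open unit ball. -/
def OpenUnitBall.center (E : Type*) [NormedAddCommGroup E] : OpenUnitBall E :=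
  ⟨0, Metric.mem_ball_self one_pos⟩

section Spaces

variable (E F : Type*) [NormedAddCommGroup E] [NormedSpace ℂ E]
  [NormedAddCommGroup F] [NormedSpace ℂ F]

/-- A function on the open unit ball is holomorphic if it is complex Fréchet differentiable at
every point of the ball. As Mathlib's differentiability is about functions on the whole space, this
is said of a function on `E` with the given values on the ball; as the ball is open, the values
elsewhere do not matter. -/
def IsHolomorphicOnBall {E F : Type*} [NormedAddCommGroup E] [NormedSpace ℂ E]
    [NormedAddCommGroup F] [NormedSpace ℂ F] (f : OpenUnitBall E → F) : Prop :=
  ∃ g : E → F, DifferentiableOn ℂ g (Metric.ball 0 1) ∧ ∀ x : OpenUnitBall E, g x = f x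

/-- The vector space of holomorphic Lipschitz functions `f : B_E → F` with `f 0 = 0`. -/
def holLipSubmodule : Submodule ℂ (OpenUnitBall E → F) where
  carrier := {f | IsHolomorphicOnBall f ∧
    (∃ C : ℝ, ∀ x y : OpenUnitBall E, ‖f x - f y‖ ≤ C * ‖(x : E) - y‖) ∧
    f (OpenUnitBall.center E) = 0}
  add_mem' := by
    rintro f g ⟨⟨f₁, hf₁, hf₂⟩, ⟨C, hC⟩, hf⟩ ⟨⟨g₁, hg₁, hg₂⟩, ⟨D, hD⟩, hg⟩
    refine ⟨⟨f₁ + g₁, hf₁.add hg₁, fun x => by simp [hf₂, hg₂]⟩, ⟨C + D, fun x y => ?_⟩,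
      by simp [hf, hg]⟩
    calc ‖(f + g) x - (f + g) y‖ = ‖(f x - f y) + (g x - g y)‖ := by
          congr 1; simp only [Pi.add_apply]; abel
      _ ≤ ‖f x - f y‖ + ‖g x - g y‖ := norm_add_le _ _
      _ ≤ (C + D) * ‖(x : E) - y‖ := by rw [add_mul]; exact add_le_add (hC x y) (hD x y)
  zero_mem' := ⟨⟨0, differentiableOn_const 0, fun _ => rfl⟩, ⟨0, fun x y => by simp⟩, rfl⟩
  smul_mem' := by
    rintro c f ⟨⟨f₁, hf₁, hf₂⟩, ⟨C, hC⟩, hf⟩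
    refine ⟨⟨c • f₁, hf₁.const_smul c, fun x => by simp [hf₂]⟩, ⟨‖c‖ * C, fun x y => ?_⟩,
      by simp [hf]⟩
    rw [Pi.smul_apply, Pi.smul_apply, ← smul_sub, norm_smul, mul_assoc]
    exact mul_le_mul_of_nonneg_left (hC x y) (norm_nonneg c)

/-- The space `HL₀(B_E, F)` of holomorphic Lipschitz functions `f : B_E → F` with `f 0 = 0`.
(A type of its own, so that its topology is the one of the norm given below and not the topology of
pointwise convergence.) -/
def HolLip₀ : Type _ := ↥(holLipSubmodule E F)

namespace HolLip₀

noncomputable instance : AddCommGroup (HolLip₀ E F) :=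
  inferInstanceAs (AddCommGroup ↥(holLipSubmodule E F))

noncomputable instance : Module ℂ (HolLip₀ E F) :=
  inferInstanceAs (Module ℂ ↥(holLipSubmodule E F))

instance : FunLike (HolLip₀ E F) (OpenUnitBall E) F where
  coe f := f.1
  coe_injective _ _ h := Subtype.ext h

variable {E F}

theorem isHolomorphicOnBall (f : HolLip₀ E F) : IsHolomorphicOnBall f := f.2.1

theorem exists_lipschitz (f : HolLip₀ E F) :
    ∃ C : ℝ, ∀ x y : OpenUnitBall E, ‖f x - f y‖ ≤ C * ‖(x : E) - y‖ := f.2.2.1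

theorem map_center (f : HolLip₀ E F) : f (OpenUnitBall.center E) = 0 := f.2.2.2

theorem add_apply (f g : HolLip₀ E F) (x : OpenUnitBall E) : (f + g) x = f x + g x := rfl

theorem neg_apply (f : HolLip₀ E F) (x : OpenUnitBall E) : (-f) x = -f x := rfl

theorem zero_apply (x : OpenUnitBall E) : (0 : HolLip₀ E F) x = 0 := rfl

theorem smul_apply (c : ℂ) (f : HolLip₀ E F) (x : OpenUnitBall E) : (c • f) x = c • f x := rfl

/-- The Lipschitz constant `L(f) = sup_{x ≠ y} ‖f x - f y‖ / ‖x - y‖`.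
(The pairs with `x = y` contribute `0 / 0 = 0`.) -/
noncomputable def lipConst (f : HolLip₀ E F) : ℝ :=
  ⨆ p : OpenUnitBall E × OpenUnitBall E, ‖f p.1 - f p.2‖ / ‖(p.1 : E) - p.2‖

theorem div_le_of_bound {f : HolLip₀ E F} {C : ℝ} (hC₀ : 0 ≤ C)
    (hC : ∀ x y : OpenUnitBall E, ‖f x - f y‖ ≤ C * ‖(x : E) - y‖)
    (p : OpenUnitBall E × OpenUnitBall E) : ‖f p.1 - f p.2‖ / ‖(p.1 : E) - p.2‖ ≤ C :=
  div_le_of_le_mul₀ (norm_nonneg _) hC₀ (hC p.1 p.2)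

theorem lipConst_nonneg (f : HolLip₀ E F) : 0 ≤ lipConst f :=
  Real.iSup_nonneg fun _ => div_nonneg (norm_nonneg _) (norm_nonneg _)

theorem lipConst_le {f : HolLip₀ E F} {C : ℝ} (hC₀ : 0 ≤ C)
    (hC : ∀ x y : OpenUnitBall E, ‖f x - f y‖ ≤ C * ‖(x : E) - y‖) : lipConst f ≤ C :=
  Real.iSup_le (div_le_of_bound hC₀ hC) hC₀

theorem norm_sub_le_lipConst (f : HolLip₀ E F) (x y : OpenUnitBall E) :
    ‖f x - f y‖ ≤ lipConst f * ‖(x : E) - y‖ := by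
  obtain ⟨C, hC⟩ := f.exists_lipschitz
  have hC' : ∀ x y : OpenUnitBall E, ‖f x - f y‖ ≤ |C| * ‖(x : E) - y‖ := fun x y =>
    (hC x y).trans (mul_le_mul_of_nonneg_right (le_abs_self C) (norm_nonneg _))
  rcases (norm_nonneg ((x : E) - y)).eq_or_lt with h | h
  · simpa [← h] using hC x y
  · rw [← div_le_iff₀ h]
    exact le_ciSup (f := fun p : OpenUnitBall E × OpenUnitBall E =>
      ‖f p.1 - f p.2‖ / ‖(p.1 : E) - p.2‖)
      ⟨|C|, Set.forall_mem_range.2 (div_le_of_bound (abs_nonneg C) hC')⟩ (x, y)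

/-- The Lipschitz constant is a norm on `HL₀(B_E, F)`. -/
noncomputable def lipNorm (E F : Type*) [NormedAddCommGroup E] [NormedSpace ℂ E]
    [NormedAddCommGroup F] [NormedSpace ℂ F] : AddGroupNorm (HolLip₀ E F) where
  toFun := lipConst
  map_zero' := le_antisymm (lipConst_le le_rfl fun x y => by simp [zero_apply])
    (lipConst_nonneg 0)
  add_le' f g := by
    refine lipConst_le (add_nonneg (lipConst_nonneg f) (lipConst_nonneg g)) fun x y => ?_
    calc ‖(f + g) x - (f + g) y‖ = ‖(f x - f y) + (g x - g y)‖ := by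
          congr 1; simp only [add_apply]; abel
      _ ≤ ‖f x - f y‖ + ‖g x - g y‖ := norm_add_le _ _
      _ ≤ (lipConst f + lipConst g) * ‖(x : E) - y‖ := by
          rw [add_mul]
          exact add_le_add (norm_sub_le_lipConst f x y) (norm_sub_le_lipConst g x y)
  neg' f := by
    simp only [lipConst, neg_apply]
    refine iSup_congr fun p => ?_
    rw [← norm_neg]
    congr 2
    abel
  eq_zero_of_map_eq_zero' f hf := by
    refine DFunLike.ext _ _ fun x => ?_
    have h := norm_sub_le_lipConst f x (OpenUnitBall.center E)
    rw [show lipConst f = 0 from hf, map_center, zero_mul, sub_zero] at h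
    exact norm_le_zero_iff.1 h

/-- `HL₀(B_E, F)` is normed by `‖f‖ = L(f)`. -/
noncomputable instance : NormedAddCommGroup (HolLip₀ E F) :=
  (lipNorm E F).toNormedAddCommGroup

theorem norm_def (f : HolLip₀ E F) : ‖f‖ = lipConst f := rfl

noncomputable instance : NormedSpace ℂ (HolLip₀ E F) where
  norm_smul_le c f := by
    refine lipConst_le (mul_nonneg (norm_nonneg c) (lipConst_nonneg f)) fun x y => ?_
    rw [smul_apply, smul_apply, ← smul_sub, norm_smul, mul_assoc]
    exact mul_le_mul_of_nonneg_left (norm_sub_le_lipConst f x y) (norm_nonneg c)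

end HolLip₀

end Spaces

section Composition

variable {X Y : Type*} [NormedAddCommGroup X] [NormedSpace ℂ X]
  [NormedAddCommGroup Y] [NormedSpace ℂ Y]

/-- The map `B_Y → B_X` given by a symbol `φ ∈ HL₀(B_Y, X)` with `φ(B_Y) ⊆ B_X`. -/
def HolLip₀.ballMap (φ : HolLip₀ Y X) (hφ : ∀ y, φ y ∈ Metric.ball (0 : X) 1) :
    OpenUnitBall Y → OpenUnitBall X :=
  fun y => ⟨φ y, hφ y⟩

/-- The composition operator `C_φ : HL₀(B_X) → HL₀(B_Y)`, `C_φ f = f ∘ φ`, of a symbol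
`φ ∈ HL₀(B_Y, X)` with `φ(B_Y) ⊆ B_X`. -/
noncomputable def compositionOperator (φ : HolLip₀ Y X)
    (hφ : ∀ y, φ y ∈ Metric.ball (0 : X) 1) : HolLip₀ X ℂ →ₗ[ℂ] HolLip₀ Y ℂ where
  toFun f := ⟨fun y => f (φ.ballMap hφ y), by
    refine ⟨?_, ?_, ?_⟩
    · obtain ⟨g, hg, hgf⟩ := f.isHolomorphicOnBall
      obtain ⟨p, hp, hpφ⟩ := φ.isHolomorphicOnBall
      refine ⟨g ∘ p, hg.comp hp fun y hy => ?_, fun y => ?_⟩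
      · have := hφ ⟨y, hy⟩
        rwa [← hpφ ⟨y, hy⟩] at this
      · rw [Function.comp_apply, hpφ y]
        exact hgf (φ.ballMap hφ y)
    · refine ⟨f.lipConst * φ.lipConst, fun x y => ?_⟩
      refine (f.norm_sub_le_lipConst _ _).trans ?_
      rw [mul_assoc]
      exact mul_le_mul_of_nonneg_left (φ.norm_sub_le_lipConst x y) f.lipConst_nonneg
    · have h : φ.ballMap hφ (OpenUnitBall.center Y) = OpenUnitBall.center X :=
        Subtype.ext φ.map_center
      change f (φ.ballMap hφ (OpenUnitBall.center Y)) = 0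
      rw [h]
      exact f.map_center⟩
  map_add' _ _ := rfl
  map_smul' _ _ := rfl

theorem compositionOperator_apply (φ : HolLip₀ Y X) (hφ : ∀ y, φ y ∈ Metric.ball (0 : X) 1)
    (f : HolLip₀ X ℂ) (y : OpenUnitBall Y) :
    compositionOperator φ hφ f y = f (φ.ballMap hφ y) := rfl

end Composition

/-- The bounded approximation property of a complex normed space: for some `l > 0` the identity can
be approximated, uniformly on compact sets, by bounded finite-rank operators of norm at most `l`. -/
def HasBAP (Y : Type*) [NormedAddCommGroup Y] [NormedSpace ℂ Y] : Prop :=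
  ∃ l : ℝ, 0 < l ∧ ∀ K : Set Y, IsCompact K → ∀ ε : ℝ, 0 < ε →
    ∃ T : Y →L[ℂ] Y, FiniteDimensional ℂ (LinearMap.range (T : Y →ₗ[ℂ] Y)) ∧ ‖T‖ ≤ l ∧
      ∀ y ∈ K, ‖T y - y‖ < ε

/-!
The heart of the matter is that an isomorphism `A = C_φ` forces `φ` to be biholomorphic. Restricting
`A⁻¹` to functionals defines `u : B_X → Y**`, `u x e = (A⁻¹ e) x`, which is holomorphic and Lipschitz
(`HolLip₀.exists_transpose`) and satisfies `u ∘ φ = id`. As `A` is injective, an element of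
`HL₀(B_X)` vanishing on `φ(B_Y)` is zero (`HolLip₀.eq_zero_of_injective`). Applied to the composites
of `u` with functionals on `Y**` that vanish on `Y`, this shows that `u` takes values in `Y`
(`HolLip₀.mem_of_injective`), so that it is a map `p ∈ HL₀(B_X, Y)`. As `A⁻¹` is multiplicative,
applying it to `e / (a - e)` for a functional `e` and `a > 1 = ‖e‖` shows that `‖p x‖ ≤ 1`
(`HolLip₀.norm_le_one_of_symm_apply`), whence `p(B_X) ⊆ B_Y` by the Schwarz lemma. Finally `φ ∘ p`
is the identity, because it is so on `φ(B_Y)` (`HolLip₀.exists_inverse_symbol`).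

A biholomorphic map of unit balls fixing the centre is a linear isometry, by the Schwarz lemma and
Cartan's uniqueness theorem (`HolLip₀.exists_linearIsometryEquiv`). The latter, `cartan_uniqueness`,
is proved for normed spaces without power series: if a self-map `f` of the ball is tangent to the
identity, so are its iterates, and the Schwarz lemma of higher order bounds `f^[n] x - x` uniformly
in `n`; averaging the telescoping sum for `f^[n] x - x` improves the order of contact of `f` with the
identity, again and again.
-/

open Metric Set Filter Asymptotics
open scoped Topology

/-! ### Holomorphic maps between normed spaces -/

section Holomorphy

variable {E F G : Type*} [NormedAddCommGroup E] [NormedSpace ℂ E]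
  [NormedAddCommGroup F] [NormedSpace ℂ F] [NormedAddCommGroup G] [NormedSpace ℂ G]

/-- The first-order Taylor remainder of a holomorphic map is quadratic, with a constant depending
only on the Lipschitz bound `C` at the centre and on the radius. -/
theorem norm_sub_sub_fderiv_le {u : E → F} {c z : E} {r C : ℝ} (hC : 0 ≤ C)
    (hu : DifferentiableOn ℂ u (ball c r)) (hlip : ∀ w ∈ ball c r, ‖u w - u c‖ ≤ C * ‖w - c‖)
    (hz : z ∈ ball c r) :
    ‖u z - u c - fderiv ℂ u c (z - c)‖ ≤ 2 * C * r * (‖z - c‖ / r) ^ 2 := by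
  have hr : 0 < r := nonempty_ball.1 ⟨z, hz⟩
  have hc : ball c r ∈ 𝓝 c := ball_mem_nhds c hr
  have hD : ‖fderiv ℂ u c‖ ≤ C :=
    norm_fderiv_le_of_lip' ℂ hC (mem_of_superset hc hlip)
  have hdiff : HasFDerivAt u (fderiv ℂ u c) c := (hu.differentiableAt hc).hasFDerivAt
  have key := Complex.dist_le_mul_div_pow_of_mapsTo_ball_of_isLittleO
    (f := fun w => u w - fderiv ℂ u c (w - c)) (c := c) (z := z) (R₁ := r) (R₂ := 2 * C * r)
    (n := 1) (hu.sub (by fun_prop)) ?_ ?_ hz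
  · simpa [dist_eq_norm, sub_right_comm] using key
  · intro w hw
    have hwr : ‖w - c‖ ≤ r := (mem_ball_iff_norm.1 hw).le
    rw [mem_closedBall_iff_norm]
    calc ‖u w - fderiv ℂ u c (w - c) - (u c - fderiv ℂ u c (c - c))‖
        = ‖(u w - u c) - fderiv ℂ u c (w - c)‖ := by simp [sub_right_comm]
      _ ≤ ‖u w - u c‖ + ‖fderiv ℂ u c (w - c)‖ := norm_sub_le _ _
      _ ≤ C * ‖w - c‖ + C * ‖w - c‖ :=
          add_le_add (hlip w hw) (ContinuousLinearMap.le_of_opNorm_le _ hD _)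
      _ ≤ 2 * C * r := by nlinarith [mul_le_mul_of_nonneg_left hwr hC]
  · simpa [sub_right_comm] using hdiff.isLittleO.norm_right

/-- A Lipschitz operator-valued map on the unit ball is holomorphic as soon as it is so pointwise:
the quadratic bound on the Taylor remainders is uniform over unit vectors `v`. -/
theorem differentiableOn_ball_of_apply {u : E → F →L[ℂ] G} {C : ℝ} (hC : 0 ≤ C)
    (hu : ∀ v, DifferentiableOn ℂ (fun x => u x v) (ball 0 1))
    (hlip : ∀ x ∈ ball (0 : E) 1, ∀ y ∈ ball (0 : E) 1, ‖u x - u y‖ ≤ C * ‖x - y‖) :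
    DifferentiableOn ℂ u (ball 0 1) := by
  intro c hc
  obtain ⟨r, hr, hball⟩ := Metric.isOpen_ball.mem_nhds hc |> Metric.mem_nhds_iff.1
  have hcr : ball c r ∈ 𝓝 c := ball_mem_nhds c hr
  have hd : ∀ v, DifferentiableAt ℂ (fun x => u x v) c := fun v =>
    (hu v).differentiableAt (isOpen_ball.mem_nhds hc)
  have hlip' : ∀ v, ∀ x ∈ ball c r, ‖u x v - u c v‖ ≤ C * ‖v‖ * ‖x - c‖ := fun v x hx => by
    rw [← sub_apply, mul_right_comm]
    exact (u x - u c).le_of_opNorm_le (hlip x (hball hx) c hc) v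
  have hD : ∀ v, ‖fderiv ℂ (fun x => u x v) c‖ ≤ C * ‖v‖ := fun v =>
    norm_fderiv_le_of_lip' ℂ (by positivity) (mem_of_superset hcr (hlip' v))
  let D : E →L[ℂ] F →L[ℂ] G := LinearMap.mkContinuous₂
    (LinearMap.mk₂ ℂ (fun h v => fderiv ℂ (fun x => u x v) c h)
      (fun _ _ _ => map_add _ _ _) (fun _ _ _ => map_smul _ _ _)
      (fun h v w => by
        have := fderiv_fun_add (hd v) (hd w)
        simp only [map_add]
        rw [this]; rfl)
      (fun a h v => by
        have := fderiv_fun_const_smul (hd v) a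
        simp only [map_smul]
        rw [this]; rfl)) C
    (fun h v => by
      rw [mul_right_comm]
      exact (fderiv ℂ (fun x => u x v) c).le_of_opNorm_le (hD v) h)
  refine (HasFDerivAt.of_isLittleO (f' := D) ?_).differentiableAt.differentiableWithinAt
  have hO : (fun x => u x - u c - D (x - c)) =O[𝓝 c] fun x => ‖x - c‖ ^ 2 := by
    refine IsBigO.of_bound (2 * C * r / r ^ 2) (mem_of_superset hcr fun x hx => ?_)
    refine ContinuousLinearMap.opNorm_le_bound _ (by positivity) fun v => ?_
    refine (norm_sub_sub_fderiv_le (u := fun x => u x v) (C := C * ‖v‖) (by positivity)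
      ((hu v).mono hball) (hlip' v) hx).trans_eq ?_
    rw [norm_pow, norm_norm, div_pow]
    ring
  refine hO.trans_isLittleO ?_
  have h0 : Tendsto (fun x => ‖x - c‖) (𝓝 c) (𝓝 0) := tendsto_norm_sub_self c
  simpa [pow_two] using
    (((isLittleO_one_iff ℝ).2 h0).mul_isBigO (isBigO_refl (fun x => ‖x - c‖) (𝓝 c))).norm_right

theorem LinearIsometry.isClosed_range [CompleteSpace F] (J : F →ₗᵢ[ℂ] G) :
    IsClosed (LinearMap.range J.toLinearMap : Set G) := by
  rw [LinearMap.coe_range]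
  exact J.isometry.isClosedEmbedding.isClosed_range

/-- A map is holomorphic if it is so after composition with a linear isometry `J`. The derivative of
the composite takes values in the closed range of `J`, since it vanishes modulo this range. -/
theorem LinearIsometry.differentiableOn_of_comp [CompleteSpace F] (J : F →ₗᵢ[ℂ] G) {p : E → F}
    {s : Set E} (hs : IsOpen s) (h : DifferentiableOn ℂ (fun x => J (p x)) s) :
    DifferentiableOn ℂ p s := by
  intro c hc
  have hD := (h.differentiableAt (hs.mem_nhds hc)).hasFDerivAt
  set D := fderiv ℂ (fun x => J (p x)) c
  have hrange : ∀ v, D v ∈ LinearMap.range J.toLinearMap := by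
    have := J.isClosed_range
    let q := (LinearMap.range J.toLinearMap).mkQL
    have h1 : HasFDerivAt (fun x => q (J (p x))) (q ∘L D) c := q.hasFDerivAt.comp c hD
    have h2 : (fun x => q (J (p x))) = fun _ => 0 := by
      funext x
      exact (Submodule.Quotient.mk_eq_zero _).2 ⟨p x, rfl⟩
    rw [h2] at h1
    intro v
    have h3 := h1.unique (hasFDerivAt_const _ _)
    exact (Submodule.Quotient.mk_eq_zero _).1 (DFunLike.congr_fun h3 v)
  let D' : E →L[ℂ] F := (J.equivRange.symm.toContinuousLinearEquiv :
    LinearMap.range J.toLinearMap →L[ℂ] F) ∘L D.codRestrict _ hrange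
  have hD' : ∀ v, J (D' v) = D v := fun v =>
    congrArg Subtype.val (J.equivRange.apply_symm_apply ⟨D v, hrange v⟩)
  refine (HasFDerivAt.of_isLittleO (f' := D') ?_).differentiableAt.differentiableWithinAt
  refine (IsBigO.of_bound 1 (Eventually.of_forall fun x => ?_)).trans_isLittleO hD.isLittleO
  rw [one_mul, ← hD', ← map_sub, ← map_sub, J.norm_map]

end Holomorphy

/-! ### Cartan's uniqueness theorem -/

section Cartan

variable {E : Type*} [NormedAddCommGroup E] [NormedSpace ℂ E]

/-- If all iterates `f^[n]` agree with the identity to order `k + 2`, uniformly in `n`, then `f`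
agrees with it to order `2 * k + 3`. With `g = f - id`, the telescoping identity
`n • g x = (f^[n] x - x) - ∑ j < n, (g (f^[j] x) - g x)` is divided by `n → ∞`, the summands being
controlled by a Cauchy estimate for the derivative of `g`. -/
theorem cartan_uniqueness_step {f : E → E} {k : ℕ}
    (hd : DifferentiableOn ℂ f (ball 0 1)) (hmaps : MapsTo f (ball 0 1) (ball 0 1)) (h0 : f 0 = 0)
    (hbound : ∀ n : ℕ, ∀ x ∈ ball (0 : E) 1, ‖f^[n] x - x‖ ≤ 2 * ‖x‖ ^ (k + 2))
    {x : E} (hx : ‖x‖ < 1 / 2) :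
    ‖f x - x‖ ≤ 8 * 2 ^ (k + 2) * ‖x‖ ^ (2 * k + 3) := by
  rcases eq_or_ne x 0 with rfl | hx0
  · simp [h0]
  set ρ := ‖x‖ with hρ
  have hρ0 : 0 < ρ := norm_pos_iff.2 hx0
  set g : E → E := fun w => f w - w with hg
  have hgd : DifferentiableOn ℂ g (ball 0 1) := hd.sub differentiableOn_id
  set M := 2 * (2 * ρ) ^ (k + 2) with hM
  -- The values of `g` on the ball of radius `2 * ρ` control its derivative on half that ball.
  have hgM : ∀ w, ‖w‖ < 2 * ρ → ‖g w‖ ≤ M := fun w hw => by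
    have := hbound 1 w (by rw [mem_ball_zero_iff]; linarith)
    rw [Function.iterate_one] at this
    exact this.trans (by rw [hM]; gcongr)
  have hsub : ∀ w ∈ closedBall (0 : E) ρ, ∀ v ∈ ball w ρ, ‖v‖ < 2 * ρ := fun w hw v hv => by
    rw [mem_closedBall_zero_iff] at hw
    rw [mem_ball_iff_norm] at hv
    have := norm_add_le (v - w) w
    rw [sub_add_cancel] at this
    linarith
  have hfd : ∀ w ∈ closedBall (0 : E) ρ, ‖fderiv ℂ g w‖ ≤ 2 * M / ρ := fun w hw => by
    refine Complex.norm_fderiv_le_div_of_mapsTo_ball (R₁ := ρ) (hgd.mono fun v hv => ?_)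
      (fun v hv => ?_) hρ0
    · rw [mem_ball_zero_iff]
      linarith [hsub w hw v hv]
    · rw [mem_closedBall_iff_norm]
      linarith [norm_sub_le (g v) (g w), hgM v (hsub w hw v hv),
        hgM w (hsub w hw w (mem_ball_self hρ0))]
  have hglip : ∀ u ∈ closedBall (0 : E) ρ, ∀ v ∈ closedBall (0 : E) ρ,
      ‖g u - g v‖ ≤ 2 * M / ρ * ‖u - v‖ := fun u hu v hv => by
    let _ : NormedSpace ℝ E := NormedSpace.restrictScalars ℝ ℂ E
    refine (convex_closedBall (0 : E) ρ).norm_image_sub_le_of_norm_fderiv_le (𝕜 := ℂ)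
      (fun w hw => hgd.differentiableAt (isOpen_ball.mem_nhds ?_)) hfd hv hu
    rw [mem_closedBall_zero_iff] at hw
    rw [mem_ball_zero_iff]
    linarith
  have hxball : x ∈ ball (0 : E) 1 := by rw [mem_ball_zero_iff]; linarith
  have hiter : ∀ j : ℕ, f^[j] x ∈ closedBall (0 : E) ρ := fun j => by
    rw [mem_closedBall_zero_iff]
    induction j with
    | zero => exact le_rfl
    | succ j ih =>
      rw [Function.iterate_succ_apply']
      exact (Complex.norm_le_norm_of_mapsTo_ball hd
        (hmaps.mono_right ball_subset_closedBall) h0 (by linarith)).trans ih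
  have hterm : ∀ j : ℕ, ‖g (f^[j] x) - g x‖ ≤ 2 * M / ρ * (2 * ρ ^ (k + 2)) := fun j => by
    refine (hglip _ (hiter j) _ (hiter 0)).trans ?_
    have : 0 ≤ 2 * M / ρ := by positivity
    exact mul_le_mul_of_nonneg_left (hbound j x hxball) this
  have hsum : ∀ n : ℕ, (n : ℂ) • g x
      = (f^[n] x - x) - ∑ j ∈ Finset.range n, (g (f^[j] x) - g x) := fun n => by
    have htel : ∑ j ∈ Finset.range n, g (f^[j] x) = f^[n] x - x := by
      refine Eq.trans (Finset.sum_congr rfl fun j _ => ?_)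
        (Finset.sum_range_sub (fun j => f^[j] x) n)
      rw [Function.iterate_succ_apply']
    rw [Finset.sum_sub_distrib, htel, Finset.sum_const, Finset.card_range, Nat.cast_smul_eq_nsmul]
    abel
  have hn : ∀ n : ℕ, n * (‖g x‖ - 2 * M / ρ * (2 * ρ ^ (k + 2))) ≤ 2 * ρ ^ (k + 2) := fun n => by
    have h1 : (n : ℝ) * ‖g x‖ = ‖(n : ℂ) • g x‖ := by rw [norm_smul, Complex.norm_natCast]
    have h2 : ‖∑ j ∈ Finset.range n, (g (f^[j] x) - g x)‖
        ≤ n * (2 * M / ρ * (2 * ρ ^ (k + 2))) := by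
      simpa using norm_sum_le_of_le (Finset.range n) fun j _ => hterm j
    rw [mul_sub, h1, hsum n]
    linarith [norm_sub_le (f^[n] x - x) (∑ j ∈ Finset.range n, (g (f^[j] x) - g x)),
      hbound n x hxball]
  have hle : ‖g x‖ ≤ 2 * M / ρ * (2 * ρ ^ (k + 2)) := by
    by_contra! hlt
    obtain ⟨n, hn'⟩ := exists_nat_gt (2 * ρ ^ (k + 2) / (‖g x‖ - 2 * M / ρ * (2 * ρ ^ (k + 2))))
    rw [div_lt_iff₀ (sub_pos.2 hlt)] at hn'
    exact absurd (hn n) (not_le.2 hn')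
  refine hle.trans_eq ?_
  rw [hM]
  field_simp
  ring

/-- A holomorphic self-map of the unit ball that is tangent to the identity at `0` agrees with it to
every order, with the same constant `2`. The induction runs over all such maps at once, so that its
hypothesis applies to the iterates of `f`. -/
theorem cartan_uniqueness_bound (k : ℕ) : ∀ f : E → E, DifferentiableOn ℂ f (ball 0 1) →
    MapsTo f (ball 0 1) (ball 0 1) → f 0 = 0 → HasFDerivAt f (ContinuousLinearMap.id ℂ E) 0 →
    ∀ x ∈ ball (0 : E) 1, ‖f x - x‖ ≤ 2 * ‖x‖ ^ (k + 2) := by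
  have schwarz : ∀ (n : ℕ) (f : E → E), DifferentiableOn ℂ f (ball 0 1) →
      MapsTo f (ball 0 1) (ball 0 1) → f 0 = 0 →
      (fun x => f x - x) =o[𝓝 0] (fun x => ‖x‖ ^ n) →
      ∀ x ∈ ball (0 : E) 1, ‖f x - x‖ ≤ 2 * ‖x‖ ^ (n + 1) := by
    intro n f hd hm h0 ho x hx
    have := Complex.dist_le_mul_div_pow_of_mapsTo_ball_of_isLittleO
      (f := fun x => f x - x) (c := 0) (R₁ := 1) (R₂ := 2) (n := n) (hd.sub differentiableOn_id)
      (fun w hw => ?_) (by simpa [h0] using ho) hx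
    · simpa [h0, dist_eq_norm] using this
    · have h1 := mem_ball_zero_iff.1 (hm hw)
      have h2 := mem_ball_zero_iff.1 hw
      simp only [h0, sub_zero, mem_closedBall_zero_iff]
      linarith [norm_sub_le (f w) w]
  induction k with
  | zero =>
    intro f hd hm h0 hf
    refine schwarz 1 f hd hm h0 ?_
    simpa [h0] using hf.isLittleO.norm_right
  | succ k ih =>
    intro f hd hm h0 hf
    refine schwarz (k + 2) f hd hm h0 ?_
    have hiter : ∀ n : ℕ, ∀ x ∈ ball (0 : E) 1, ‖f^[n] x - x‖ ≤ 2 * ‖x‖ ^ (k + 2) := fun n => by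
      refine ih f^[n] ?_ (hm.iterate n) (Function.iterate_fixed h0 n) ?_
      · induction n with
        | zero => exact differentiableOn_id
        | succ n ihn => rw [Function.iterate_succ']; exact hd.comp ihn (hm.iterate n)
      · have := hf.iterate h0 n
        have hid : (ContinuousLinearMap.id ℂ E) ^ n = ContinuousLinearMap.id ℂ E := one_pow n
        rwa [hid] at this
    have hO : (fun x => f x - x) =O[𝓝 0] fun x => ‖x‖ ^ (2 * k + 3) := by
      refine IsBigO.of_bound (8 * 2 ^ (k + 2))
        (mem_of_superset (ball_mem_nhds (0 : E) one_half_pos) fun x hx => ?_)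
      rw [mem_ofPred_eq, norm_pow, norm_norm]
      exact cartan_uniqueness_step hd hm h0 hiter (mem_ball_zero_iff.1 hx)
    refine hO.trans_isLittleO ?_
    have hlt : k + 2 < 2 * k + 3 := by omega
    exact (isLittleO_pow_pow (𝕜 := ℝ) hlt).comp_tendsto tendsto_norm_zero

/-- **Cartan's uniqueness theorem** for the open unit ball of a normed space. -/
theorem cartan_uniqueness {f : E → E} (hd : DifferentiableOn ℂ f (ball 0 1))
    (hmaps : MapsTo f (ball 0 1) (ball 0 1)) (h0 : f 0 = 0)
    (hf : HasFDerivAt f (ContinuousLinearMap.id ℂ E) 0) {x : E} (hx : x ∈ ball (0 : E) 1) :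
    f x = x := by
  have hlim : Tendsto (fun k : ℕ => 2 * ‖x‖ ^ (k + 2)) atTop (𝓝 (2 * 0)) :=
    (((tendsto_pow_atTop_nhds_zero_of_lt_one (norm_nonneg x)
      (mem_ball_zero_iff.1 hx)).comp (tendsto_add_atTop_nat 2))).const_mul 2
  rw [mul_zero] at hlim
  exact sub_eq_zero.1 (norm_le_zero_iff.1 (ge_of_tendsto' hlim fun k =>
    cartan_uniqueness_bound k f hd hmaps h0 hf x hx))

end Cartan

namespace HolLip₀

/-! ### Constructions in `HL₀` -/

section Basic

variable {E F G : Type*} [NormedAddCommGroup E] [NormedSpace ℂ E]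
  [NormedAddCommGroup F] [NormedSpace ℂ F] [NormedAddCommGroup G] [NormedSpace ℂ G]

/-- The element of `HL₀(B_E, F)` given by a function on the whole space that is holomorphic and
Lipschitz on the open unit ball and vanishes at `0`. -/
def ofFun (g : E → F) (hg : DifferentiableOn ℂ g (ball 0 1)) (C : ℝ)
    (hC : ∀ x ∈ ball (0 : E) 1, ∀ y ∈ ball (0 : E) 1, ‖g x - g y‖ ≤ C * ‖x - y‖)
    (h0 : g 0 = 0) : HolLip₀ E F :=
  ⟨fun x => g x, ⟨g, hg, fun _ => rfl⟩, ⟨C, fun x y => hC x x.2 y y.2⟩, h0⟩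

theorem ofFun_apply (g : E → F) (hg : DifferentiableOn ℂ g (ball 0 1)) (C : ℝ)
    (hC : ∀ x ∈ ball (0 : E) 1, ∀ y ∈ ball (0 : E) 1, ‖g x - g y‖ ≤ C * ‖x - y‖)
    (h0 : g 0 = 0) (x : OpenUnitBall E) : ofFun g hg C hC h0 x = g x := rfl

theorem norm_apply_le (f : HolLip₀ E F) (x : OpenUnitBall E) : ‖f x‖ ≤ ‖f‖ * ‖(x : E)‖ := by
  have h := f.norm_sub_le_lipConst x (OpenUnitBall.center E)
  rw [map_center, sub_zero] at h
  simpa [norm_def, OpenUnitBall.center] using h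

theorem norm_apply_le_norm (f : HolLip₀ E F) (x : OpenUnitBall E) : ‖f x‖ ≤ ‖f‖ :=
  (f.norm_apply_le x).trans
    (mul_le_of_le_one_right (norm_nonneg f) (mem_ball_zero_iff.1 x.2).le)

/-- The restriction of a bounded functional to the open unit ball, as a bounded linear map
`E* → HL₀(B_E)`. -/
noncomputable def restrictDual : StrongDual ℂ E →L[ℂ] HolLip₀ E ℂ :=
  LinearMap.mkContinuous
    { toFun := fun e => ofFun e e.differentiableOn ‖e‖
        (fun x _ y _ => by rw [← map_sub]; exact e.le_opNorm _) (map_zero e)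
      map_add' := fun _ _ => rfl
      map_smul' := fun _ _ => rfl } 1
    (fun e => by
      rw [one_mul]
      exact lipConst_le (norm_nonneg e) fun x y => by
        change ‖e x - e y‖ ≤ _
        rw [← map_sub]
        exact e.le_opNorm _)

theorem restrictDual_apply (e : StrongDual ℂ E) (x : OpenUnitBall E) :
    restrictDual e x = e x := rfl

/-- `HL₀(B_E)` is closed under pointwise products, its members being bounded. -/
theorem exists_mul (f g : HolLip₀ E ℂ) : ∃ h : HolLip₀ E ℂ, ∀ x, h x = f x * g x := by
  refine ⟨⟨fun x => f x * g x, ?_, ⟨2 * ‖f‖ * ‖g‖, fun x y => ?_⟩, ?_⟩, fun _ => rfl⟩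
  · obtain ⟨f₁, hf₁, hf₂⟩ := f.isHolomorphicOnBall
    obtain ⟨g₁, hg₁, hg₂⟩ := g.isHolomorphicOnBall
    exact ⟨fun x => f₁ x * g₁ x, hf₁.mul hg₁, fun x => congrArg₂ _ (hf₂ x) (hg₂ x)⟩
  · calc ‖f x * g x - f y * g y‖ = ‖f x * (g x - g y) + (f x - f y) * g y‖ := by
          congr 1; ring
      _ ≤ ‖f x‖ * ‖g x - g y‖ + ‖f x - f y‖ * ‖g y‖ := by
          simpa only [norm_mul] using norm_add_le (f x * (g x - g y)) ((f x - f y) * g y)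
      _ ≤ ‖f‖ * (‖g‖ * ‖(x : E) - y‖) + ‖f‖ * ‖(x : E) - y‖ * ‖g‖ := by
          gcongr
          · exact f.norm_apply_le_norm x
          · exact g.norm_sub_le_lipConst x y
          · exact f.norm_sub_le_lipConst x y
          · exact g.norm_apply_le_norm y
      _ = 2 * ‖f‖ * ‖g‖ * ‖(x : E) - y‖ := by ring
  · change f _ * g _ = 0
    rw [map_center, zero_mul]

open Classical in
/-- The evaluation functional `δ_x : f ↦ f x` on `HL₀(B_E)`, extended by `0` to points `x` outside
the open unit ball. -/
noncomputable def evalDual (x : E) : StrongDual ℂ (HolLip₀ E ℂ) :=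
  if hx : x ∈ ball (0 : E) 1 then
    LinearMap.mkContinuous
      { toFun := fun f => f ⟨x, hx⟩
        map_add' := fun _ _ => rfl
        map_smul' := fun _ _ => rfl } 1
      (fun f => by rw [one_mul]; exact f.norm_apply_le_norm ⟨x, hx⟩)
  else 0

theorem evalDual_apply (x : OpenUnitBall E) (f : HolLip₀ E ℂ) : evalDual (x : E) f = f x := by
  rw [evalDual, dif_pos x.2]
  rfl

theorem evalDual_zero : evalDual (0 : E) = 0 := by
  ext f
  exact (evalDual_apply (OpenUnitBall.center E) f).trans f.map_center

theorem norm_evalDual_sub_le {x y : E} (hx : x ∈ ball (0 : E) 1) (hy : y ∈ ball (0 : E) 1) :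
    ‖evalDual x - evalDual y‖ ≤ ‖x - y‖ := by
  refine ContinuousLinearMap.opNorm_le_bound _ (norm_nonneg _) fun f => ?_
  rw [sub_apply, evalDual_apply ⟨x, hx⟩, evalDual_apply ⟨y, hy⟩, mul_comm]
  exact f.norm_sub_le_lipConst ⟨x, hx⟩ ⟨y, hy⟩

/-- A bounded linear map `B : W → HL₀(B_E)` transposes to a holomorphic Lipschitz map
`B_E → W*`, namely `x ↦ (w ↦ B w x)`. -/
theorem exists_transpose {W : Type*} [NormedAddCommGroup W] [NormedSpace ℂ W]
    (B : W →L[ℂ] HolLip₀ E ℂ) : ∃ u : HolLip₀ E (StrongDual ℂ W), ∀ x w, u x w = B w x := by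
  have hlip : ∀ x ∈ ball (0 : E) 1, ∀ y ∈ ball (0 : E) 1,
      ‖evalDual x ∘L B - evalDual y ∘L B‖ ≤ ‖B‖ * ‖x - y‖ := fun x hx y hy => by
    rw [← ContinuousLinearMap.sub_comp, mul_comm]
    exact (ContinuousLinearMap.opNorm_comp_le _ _).trans
      (mul_le_mul_of_nonneg_right (norm_evalDual_sub_le hx hy) (norm_nonneg B))
  refine ⟨ofFun (fun x => evalDual x ∘L B) (differentiableOn_ball_of_apply (norm_nonneg B)
    (fun w => ?_) hlip) ‖B‖ hlip (by rw [evalDual_zero, ContinuousLinearMap.zero_comp]),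
    fun x w => evalDual_apply x (B w)⟩
  obtain ⟨g, hg, hgf⟩ := (B w).isHolomorphicOnBall
  exact hg.congr fun x hx => (evalDual_apply ⟨x, hx⟩ (B w)).trans (hgf ⟨x, hx⟩).symm

/-- For `a > 1 ≥ ‖e‖` the function `e / (a - e)` belongs to `HL₀(B_E)`; up to the factor `a` it is
`1 / (a - e)` normalised to vanish at the centre. -/
theorem exists_inv_sub (e : StrongDual ℂ E) (he : ‖e‖ ≤ 1) {a : ℝ} (ha : 1 < a) :
    ∃ f : HolLip₀ E ℂ, ∀ x, f x * (a - e x) = e x := by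
  have hlow : ∀ x ∈ ball (0 : E) 1, a - 1 ≤ ‖(a : ℂ) - e x‖ := fun x hx => by
    have h1 : ‖e x‖ ≤ 1 := (e.le_of_opNorm_le he x).trans
      (by rw [one_mul]; exact (mem_ball_zero_iff.1 hx).le)
    have h2 := norm_sub_norm_le (a : ℂ) (e x)
    rw [Complex.norm_real, Real.norm_of_nonneg (by linarith)] at h2
    linarith
  have ha1 : 0 < a - 1 := by linarith
  have hne : ∀ x ∈ ball (0 : E) 1, (a : ℂ) - e x ≠ 0 := fun x hx =>
    norm_pos_iff.1 (ha1.trans_le (hlow x hx))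
  refine ⟨ofFun (fun x => e x / (a - e x)) ?_ (a / ((a - 1) * (a - 1))) (fun x hx y hy => ?_)
    (by simp), fun x => ?_⟩
  · simp only [div_eq_mul_inv]
    exact e.differentiableOn.mul ((e.differentiableOn.const_sub _).inv hne)
  · have hsub : e x / (a - e x) - e y / (a - e y)
        = a * e (x - y) / ((a - e x) * (a - e y)) := by
      have := hne x hx
      have := hne y hy
      rw [map_sub]
      field_simp
      ring
    rw [hsub, norm_div, norm_mul, norm_mul, Complex.norm_real, Real.norm_of_nonneg (by linarith),
      div_mul_eq_mul_div]
    have := e.le_of_opNorm_le he (x - y)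
    rw [one_mul] at this
    gcongr
    · exact hlow x hx
    · exact hlow y hy
  · rw [ofFun_apply, div_mul_cancel₀ _ (hne x x.2)]

/-- Composition of an element of `HL₀(B_E, F)` with a bounded linear map `F → G`. -/
def compCLM (L : F →L[ℂ] G) (u : HolLip₀ E F) : HolLip₀ E G :=
  ⟨fun x => L (u x), by
    obtain ⟨g, hg, hgu⟩ := u.isHolomorphicOnBall
    exact ⟨fun x => L (g x), L.differentiable.comp_differentiableOn hg, fun x => congrArg L (hgu x)⟩,
    ⟨‖L‖ * ‖u‖, fun x y => by
      rw [← map_sub, mul_assoc]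
      exact (L.le_opNorm _).trans
        (mul_le_mul_of_nonneg_left (u.norm_sub_le_lipConst x y) (norm_nonneg L))⟩,
    (congrArg L u.map_center).trans (map_zero L)⟩

theorem compCLM_apply (L : F →L[ℂ] G) (u : HolLip₀ E F) (x : OpenUnitBall E) :
    compCLM L u x = L (u x) := rfl

/-- A holomorphic Lipschitz map into the range of a linear isometry `J` factors through `J`. -/
theorem exists_lift [CompleteSpace F] (J : F →ₗᵢ[ℂ] G) (u : HolLip₀ E G)
    (hu : ∀ x, u x ∈ LinearMap.range J.toLinearMap) :
    ∃ p : HolLip₀ E F, ∀ x, J (p x) = u x := by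
  choose p hp using hu
  have hp' : ∀ x, J (p x) = u x := hp
  refine ⟨⟨p, ?_, ⟨‖u‖, fun x y => ?_⟩, J.injective ?_⟩, hp⟩
  · classical
    obtain ⟨g, hg, hgu⟩ := u.isHolomorphicOnBall
    refine ⟨fun x => if hx : x ∈ ball (0 : E) 1 then p ⟨x, hx⟩ else 0,
      J.differentiableOn_of_comp isOpen_ball
      (hg.congr fun x hx => ?_), fun x => dif_pos x.2⟩
    rw [dif_pos hx, hgu ⟨x, hx⟩]
    exact hp' ⟨x, hx⟩
  · rw [← J.norm_map, map_sub, hp', hp']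
    exact u.norm_sub_le_lipConst x y
  · rw [hp', u.map_center, map_zero]

end Basic

/-! ### Composition operators and their symbols -/

section Symbol

variable {X Y : Type*} [NormedAddCommGroup X] [NormedSpace ℂ X]
  [NormedAddCommGroup Y] [NormedSpace ℂ Y]
  {φ : HolLip₀ Y X} {hφ : ∀ y, φ y ∈ ball (0 : X) 1}

theorem injective_of_equiv {A : HolLip₀ X ℂ ≃L[ℂ] HolLip₀ Y ℂ}
    (hA : ∀ f, A f = compositionOperator φ hφ f) :
    Function.Injective (compositionOperator φ hφ) := fun f g h =>
  A.injective (by rw [hA, hA, h])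

/-- The uniqueness principle behind the construction of `φ⁻¹`: identities between elements of
`HL₀(B_X)` need only be checked on `φ(B_Y)`. -/
theorem eq_zero_of_injective (hinj : Function.Injective (compositionOperator φ hφ))
    {f : HolLip₀ X ℂ} (hf : ∀ y, f (φ.ballMap hφ y) = 0) : f = 0 :=
  hinj (by rw [map_zero]; exact DFunLike.ext _ _ hf)

/-- If the composition operator of `φ` is injective, a holomorphic Lipschitz map that sends `φ(B_Y)`
into a closed subspace sends all of `B_X` into it: functionals vanishing on the subspace turn the map
into elements of `HL₀(B_X)` that vanish on `φ(B_Y)`. -/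
theorem mem_of_injective {V : Type*} [NormedAddCommGroup V] [NormedSpace ℂ V]
    (hinj : Function.Injective (compositionOperator φ hφ)) (M : Submodule ℂ V)
    (hM : IsClosed (M : Set V)) (u : HolLip₀ X V) (hu : ∀ y, u (φ.ballMap hφ y) ∈ M)
    (x : OpenUnitBall X) : u x ∈ M := by
  by_contra hnot
  have hq : ‖M.mkQL (u x)‖ ≠ 0 := fun h =>
    hnot ((Submodule.Quotient.mk_eq_zero M).1 (norm_eq_zero.1 h))
  obtain ⟨l, -, hl⟩ := exists_dual_vector ℂ _ hq
  have hf := eq_zero_of_injective hinj (f := compCLM (l ∘L M.mkQL) u) fun y => by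
    have : M.mkQL (u (φ.ballMap hφ y)) = 0 := (Submodule.Quotient.mk_eq_zero M).2 (hu y)
    rw [compCLM_apply, ContinuousLinearMap.comp_apply, this, map_zero]
  have hx := DFunLike.congr_fun hf x
  rw [compCLM_apply, ContinuousLinearMap.comp_apply, hl, zero_apply] at hx
  exact hq (Complex.ofReal_eq_zero.1 hx)

/-- If `u` agrees on `φ(B_Y)` with the inverse of `φ`, read in a larger space through `J`, then `u`
takes values in `J(Y)` on all of `B_X`. -/
theorem exists_lift_of_injective {V : Type*} [NormedAddCommGroup V] [NormedSpace ℂ V]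
    [CompleteSpace Y] (hinj : Function.Injective (compositionOperator φ hφ)) (J : Y →ₗᵢ[ℂ] V)
    (u : HolLip₀ X V) (hu : ∀ y, u (φ.ballMap hφ y) = J y) :
    ∃ p : HolLip₀ X Y, ∀ x, J (p x) = u x :=
  exists_lift J u (mem_of_injective hinj _ J.isClosed_range u fun y => ⟨(y : Y), (hu y).symm⟩)

/-- A symbol whose composition operator is an isomorphism has a holomorphic Lipschitz left inverse
`p`, by which the inverse operator acts on functionals. -/
theorem exists_leftInverse_symbol [CompleteSpace Y] (A : HolLip₀ X ℂ ≃L[ℂ] HolLip₀ Y ℂ)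
    (hA : ∀ f, A f = compositionOperator φ hφ f) :
    ∃ p : HolLip₀ X Y, (∀ y, p (φ.ballMap hφ y) = y) ∧
      ∀ x (e : StrongDual ℂ Y), A.symm (restrictDual e) x = e (p x) := by
  have hinj := injective_of_equiv hA
  obtain ⟨u, hu⟩ := exists_transpose
    ((A.symm : HolLip₀ Y ℂ →L[ℂ] HolLip₀ X ℂ) ∘L restrictDual)
  have huφ : ∀ y : OpenUnitBall Y,
      u (φ.ballMap hφ y) = NormedSpace.inclusionInDoubleDualLi (E := Y) ℂ y := fun y => by
    refine ContinuousLinearMap.ext fun e => (hu _ e).trans ?_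
    have := DFunLike.congr_fun (hA (A.symm (restrictDual e))) y
    rw [A.apply_symm_apply] at this
    exact this.symm
  obtain ⟨p, hp⟩ := exists_lift_of_injective hinj _ u huφ
  refine ⟨p, fun y => ?_, fun x e => ?_⟩
  · exact (NormedSpace.inclusionInDoubleDualLi (E := Y) ℂ).injective ((hp _).trans (huφ y))
  · exact (hu x e).symm.trans (DFunLike.congr_fun (hp x) e).symm

/-- The left inverse `p` of the symbol maps into the closed unit ball. The functional
`g ↦ A⁻¹ g x` is multiplicative and has the value `e (p x)` at each functional `e`; if
`e (p x) = ‖p x‖ = a > 1 = ‖e‖`, then applying it to `e / (a - e) * (a - e) = e` gives `0 = a`. -/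
theorem norm_le_one_of_symm_apply {A : HolLip₀ X ℂ ≃L[ℂ] HolLip₀ Y ℂ}
    (hA : ∀ f, A f = compositionOperator φ hφ f) {p : HolLip₀ X Y}
    (hp : ∀ x (e : StrongDual ℂ Y), A.symm (restrictDual e) x = e (p x)) (x : OpenUnitBall X) :
    ‖p x‖ ≤ 1 := by
  have hinj := injective_of_equiv hA
  by_contra! hgt
  obtain ⟨e, he, hex⟩ := exists_dual_vector ℂ (p x) (by linarith)
  obtain ⟨f, hf⟩ := exists_inv_sub e he.le hgt
  set a : ℂ := ((‖p x‖ : ℝ) : ℂ) with ha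
  obtain ⟨m, hm⟩ := exists_mul (A.symm f) (A.symm (restrictDual e))
  have hsymm : ∀ (g : HolLip₀ Y ℂ) y, A.symm g (φ.ballMap hφ y) = g y := fun g y => by
    rw [← compositionOperator_apply, ← hA, A.apply_symm_apply]
  -- `m` is the product `A⁻¹ f * A⁻¹ e`, so this is the transported identity `f * (a - e) - e = 0`.
  have hzero : a • A.symm f + -(m + A.symm (restrictDual e)) = 0 :=
    eq_zero_of_injective hinj fun y => by
      rw [add_apply, neg_apply, add_apply, smul_apply, hm, hsymm, hsymm, restrictDual_apply,
        smul_eq_mul]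
      linear_combination hf y
  have hx := DFunLike.congr_fun hzero x
  rw [add_apply, neg_apply, add_apply, smul_apply, hm, hp, hex, smul_eq_mul, zero_apply] at hx
  have ha0 : a = 0 := by linear_combination -hx
  rw [ha, Complex.ofReal_eq_zero] at ha0
  linarith

/-- By the Schwarz lemma, a map in `HL₀(B_X, Y)` into the closed unit ball maps into the open one. -/
theorem mem_ball_of_norm_le_one {p : HolLip₀ X Y} (hp : ∀ x, ‖p x‖ ≤ 1) (x : OpenUnitBall X) :
    p x ∈ ball (0 : Y) 1 := by
  obtain ⟨g, hg, hgp⟩ := p.isHolomorphicOnBall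
  have h0 : g 0 = 0 := (hgp (OpenUnitBall.center X)).trans p.map_center
  have hx := mem_ball_zero_iff.1 x.2
  have := Complex.norm_le_norm_of_mapsTo_ball hg (fun z hz => by
    rw [mem_closedBall_zero_iff, hgp ⟨z, hz⟩]
    exact hp _) h0 hx
  rw [hgp] at this
  exact mem_ball_zero_iff.2 (this.trans_lt hx)

/-- A symbol whose composition operator is an isomorphism is biholomorphic, with inverse in
`HL₀(B_X, Y)`. -/
theorem exists_inverse_symbol [CompleteSpace Y] (A : HolLip₀ X ℂ ≃L[ℂ] HolLip₀ Y ℂ)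
    (hA : ∀ f, A f = compositionOperator φ hφ f) :
    ∃ (p : HolLip₀ X Y) (hp : ∀ x, p x ∈ ball (0 : Y) 1),
      Function.LeftInverse (p.ballMap hp) (φ.ballMap hφ) ∧
      Function.RightInverse (p.ballMap hp) (φ.ballMap hφ) := by
  obtain ⟨p, hleft, hsymm⟩ := exists_leftInverse_symbol A hA
  have hp := mem_ball_of_norm_le_one (norm_le_one_of_symm_apply hA hsymm)
  have hinj := injective_of_equiv hA
  have hl : Function.LeftInverse (p.ballMap hp) (φ.ballMap hφ) := fun y => Subtype.ext (hleft y)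
  refine ⟨p, hp, hl, fun x => Subtype.ext ?_⟩
  by_contra hne
  obtain ⟨e, -, he⟩ := exists_dual_vector ℂ ((φ.ballMap hφ (p.ballMap hp x) : X) - x)
    (norm_ne_zero_iff.2 (sub_ne_zero.2 hne))
  have hzero : compositionOperator p hp (compositionOperator φ hφ (restrictDual e))
      + -restrictDual e = 0 := eq_zero_of_injective hinj fun y => by
    rw [add_apply, neg_apply, compositionOperator_apply, compositionOperator_apply, hl y,
      add_neg_cancel]
  have hx := DFunLike.congr_fun hzero x
  rw [add_apply, neg_apply, compositionOperator_apply, compositionOperator_apply,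
    restrictDual_apply, restrictDual_apply, zero_apply, ← sub_eq_add_neg, ← map_sub, he] at hx
  exact hne (sub_eq_zero.1 (norm_eq_zero.1 (Complex.ofReal_eq_zero.1 hx)))

/-- A biholomorphic map of open unit balls that fixes the centre is a linear isometry. By the
Schwarz lemma its derivative `T` at `0` and the derivative `S` of the inverse are contractions, hence
mutually inverse isometries, and Cartan's uniqueness theorem applies to `S ∘ φ`. -/
theorem exists_linearIsometryEquiv {p : HolLip₀ X Y} {hp : ∀ x, p x ∈ ball (0 : Y) 1}
    (hl : Function.LeftInverse (p.ballMap hp) (φ.ballMap hφ))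
    (hr : Function.RightInverse (p.ballMap hp) (φ.ballMap hφ)) :
    ∃ T : Y ≃ₗᵢ[ℂ] X, ∀ y : OpenUnitBall Y, φ y = T y := by
  obtain ⟨f, hf, hfφ⟩ := φ.isHolomorphicOnBall
  obtain ⟨g, hg, hgp⟩ := p.isHolomorphicOnBall
  have hf0 : f 0 = 0 := (hfφ (OpenUnitBall.center Y)).trans φ.map_center
  have hg0 : g 0 = 0 := (hgp (OpenUnitBall.center X)).trans p.map_center
  have hfm : MapsTo f (ball 0 1) (ball 0 1) := fun y hy => by
    rw [hfφ ⟨y, hy⟩]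
    exact hφ _
  have hgm : MapsTo g (ball 0 1) (ball 0 1) := fun x hx => by
    rw [hgp ⟨x, hx⟩]
    exact hp _
  have hgf : ∀ y ∈ ball (0 : Y) 1, g (f y) = y := fun y hy => by
    rw [hfφ ⟨y, hy⟩]
    exact (hgp _).trans (congrArg Subtype.val (hl ⟨y, hy⟩))
  have hfg : ∀ x ∈ ball (0 : X) 1, f (g x) = x := fun x hx => by
    rw [hgp ⟨x, hx⟩]
    exact (hfφ _).trans (congrArg Subtype.val (hr ⟨x, hx⟩))
  set T := fderiv ℂ f 0
  set S := fderiv ℂ g 0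
  have hTd : HasFDerivAt f T 0 :=
    (hf.differentiableAt (ball_mem_nhds 0 one_pos)).hasFDerivAt
  have hSd : HasFDerivAt g S 0 :=
    (hg.differentiableAt (ball_mem_nhds 0 one_pos)).hasFDerivAt
  have hT1 : ‖T‖ ≤ 1 := Complex.norm_fderiv_le_one_of_mapsTo_ball hf
    (by rw [hf0]; exact hfm.mono_right ball_subset_closedBall) one_pos
  have hS1 : ‖S‖ ≤ 1 := Complex.norm_fderiv_le_one_of_mapsTo_ball hg
    (by rw [hg0]; exact hgm.mono_right ball_subset_closedBall) one_pos
  have hST : S ∘L T = ContinuousLinearMap.id ℂ Y := by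
    have h1 : HasFDerivAt (g ∘ f) (S ∘L T) 0 := HasFDerivAt.comp 0 (by rwa [hf0]) hTd
    exact h1.unique ((hasFDerivAt_id 0).congr_of_eventuallyEq
      (mem_of_superset (ball_mem_nhds 0 one_pos) hgf))
  have hTS : T ∘L S = ContinuousLinearMap.id ℂ X := by
    have h1 : HasFDerivAt (f ∘ g) (T ∘L S) 0 := HasFDerivAt.comp 0 (by rwa [hg0]) hSd
    exact h1.unique ((hasFDerivAt_id 0).congr_of_eventuallyEq
      (mem_of_superset (ball_mem_nhds 0 one_pos) hfg))
  have hST' : ∀ y, S (T y) = y := DFunLike.congr_fun hST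
  have hTS' : ∀ x, T (S x) = x := DFunLike.congr_fun hTS
  have hTle : ∀ y, ‖T y‖ ≤ ‖y‖ := fun y => by simpa using T.le_of_opNorm_le hT1 y
  have hSle : ∀ x, ‖S x‖ ≤ ‖x‖ := fun x => by simpa using S.le_of_opNorm_le hS1 x
  refine ⟨⟨LinearEquiv.ofLinearMap (T : Y →ₗ[ℂ] X) (S : X →ₗ[ℂ] Y) (LinearMap.ext hTS')
    (LinearMap.ext hST'), fun y => le_antisymm (hTle y) ?_⟩, fun y => ?_⟩
  · have := hSle (T y)
    rwa [hST'] at this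
  · have hcartan : S (f y) = y := by
      refine cartan_uniqueness (f := fun z => S (f z))
        (S.differentiable.comp_differentiableOn hf) (fun z hz => ?_) (by rw [hf0, map_zero])
        (hST ▸ S.hasFDerivAt.comp 0 hTd) y.2
      exact mem_ball_zero_iff.2 ((hSle _).trans_lt (mem_ball_zero_iff.1 (hfm hz)))
    rw [← hfφ]
    change f y = T y
    rw [← hcartan, hTS', hcartan]

theorem isometry_and_surjective_of_linearIsometryEquiv (T : Y ≃ₗᵢ[ℂ] X)
    (hT : ∀ y : OpenUnitBall Y, φ y = T y) :
    Isometry (compositionOperator φ hφ) ∧ Function.Surjective (compositionOperator φ hφ) := by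
  have hmem : ∀ x : OpenUnitBall X, T.symm x ∈ ball (0 : Y) 1 := fun x => by
    rw [mem_ball_zero_iff, T.symm.norm_map]
    exact mem_ball_zero_iff.1 x.2
  let p : HolLip₀ X Y := ofFun T.symm T.symm.differentiable.differentiableOn 1
    (fun x _ y _ => by rw [← map_sub, T.symm.norm_map, one_mul]) (map_zero _)
  have hr : ∀ x, φ.ballMap hφ (p.ballMap hmem x) = x := fun x =>
    Subtype.ext ((hT _).trans (T.apply_symm_apply x))
  have hl : ∀ y, p.ballMap hmem (φ.ballMap hφ y) = y := fun y =>
    Subtype.ext ((congrArg T.symm (hT y)).trans (T.symm_apply_apply y))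
  refine ⟨AddMonoidHomClass.isometry_of_norm _ fun f => le_antisymm ?_ ?_, fun g =>
    ⟨compositionOperator p hmem g, DFunLike.ext _ _ fun y => congrArg g (hl y)⟩⟩
  · refine lipConst_le (norm_nonneg f) fun x y => ?_
    refine (f.norm_sub_le_lipConst (φ.ballMap hφ x) (φ.ballMap hφ y)).trans_eq ?_
    change _ * ‖φ x - φ y‖ = _
    rw [hT, hT, ← map_sub, T.norm_map, norm_def]
  · refine lipConst_le (norm_nonneg _) fun x y => ?_
    have := (compositionOperator φ hφ f).norm_sub_le_lipConst (p.ballMap hmem x) (p.ballMap hmem y)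
    rw [compositionOperator_apply, compositionOperator_apply, hr, hr] at this
    refine this.trans_eq ?_
    change _ * ‖T.symm x - T.symm y‖ = _
    rw [← map_sub, T.symm.norm_map, norm_def]

end Symbol

end HolLip₀

theorem corollary3p17 {X Y : Type*} [NormedAddCommGroup X] [NormedSpace ℂ X] [CompleteSpace X]
    [NormedAddCommGroup Y] [NormedSpace ℂ Y] [CompleteSpace Y] (hY : HasBAP Y)
    (φ : HolLip₀ Y X) (hφ : ∀ y, φ y ∈ Metric.ball (0 : X) 1) :
    List.TFAE [
      Isometry (compositionOperator φ hφ) ∧ Function.Surjective (compositionOperator φ hφ),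
      ∃ A : HolLip₀ X ℂ ≃L[ℂ] HolLip₀ Y ℂ, ∀ f, A f = compositionOperator φ hφ f,
      ∃ h : Function.Bijective (φ.ballMap hφ), ∃ ψ : HolLip₀ X Y,
        ∀ x, ψ x = (Equiv.ofBijective (φ.ballMap hφ) h).symm x,
      ∃ T : Y ≃ₗᵢ[ℂ] X, ∀ y : OpenUnitBall Y, φ y = T y] := by
  tfae_have 1 → 2 := by
    rintro ⟨hiso, hsurj⟩
    let L : HolLip₀ X ℂ →ₗᵢ[ℂ] HolLip₀ Y ℂ :=
      ⟨compositionOperator φ hφ, (AddMonoidHomClass.isometry_iff_norm _).1 hiso⟩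
    exact ⟨(LinearIsometryEquiv.ofSurjective L hsurj).toContinuousLinearEquiv, fun _ => rfl⟩
  tfae_have 2 → 3 := by
    rintro ⟨A, hA⟩
    obtain ⟨p, hp, hl, hr⟩ := HolLip₀.exists_inverse_symbol A hA
    refine ⟨⟨hl.injective, hr.surjective⟩, p, fun x => ?_⟩
    refine congrArg Subtype.val (?_ : p.ballMap hp x = _)
    rw [Equiv.eq_symm_apply]
    exact hr x
  tfae_have 3 → 4 := by
    rintro ⟨h, ψ, hψ⟩
    have hmem : ∀ x, ψ x ∈ ball (0 : Y) 1 := fun x => by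
      rw [hψ]
      exact Subtype.prop _
    have heq : ∀ x, ψ.ballMap hmem x = (Equiv.ofBijective (φ.ballMap hφ) h).symm x := fun x =>
      Subtype.ext (hψ x)
    exact HolLip₀.exists_linearIsometryEquiv (hp := hmem) (hφ := hφ)
      (fun y => (heq _).trans (Equiv.symm_apply_apply (Equiv.ofBijective _ h) y))
      (fun x => (congrArg _ (heq x)).trans (Equiv.apply_symm_apply (Equiv.ofBijective _ h) x))
  tfae_have 4 → 1 := by
    rintro ⟨T, hT⟩
    exact HolLip₀.isometry_and_surjective_of_linearIsometryEquiv T hT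
  tfae_finish
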